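/- **Theorem 5.2 (Robust CPP).** Let $J:\mathbb R^n\to\mathbb R$, $h_1,\dots,h_m,g_1,\dots,g_p:\mathbb R^n\to\mathbb R$ be functions, $f:\mathbb R^n\times\mathbb R^d\to\mathbb R$ a measurable function, $\delta\in(0,1)$, $\epsilon>0$, and let $\phi:[0,\infty)\to\mathbb R$ be convex with $\phi(1)=0$. Let $\mathcal Y$ be a probability distribution on $\mathbb R^d$. *Notation.* For probability distributions $\mu,\nu$ let $D_\phi(\mu,\nu)=\int\phi\big(\tfrac{d\mu}{d\nu}\big)\,d\nu\in[0,\infty]$ if $\mu\ll\nu$, and $D_\phi(\mu,\nu)=\infty$ otherwise; let $\mathcal P(\mathcal Y,\epsilon)=\{\mathcal Y' : D_\phi(\mathcal Y',\mathcal Y)\le\epsilon\}$. For $\beta\in[0,1]$ and $\tau\ge 0$ put $$v(\beta)=\inf\Big\{z\in[0,1] : \beta\,\phi\big(\tfrac z\beta\big)+(1-\beta)\,\phi\big(\tfrac{1-z}{1-\beta}\big)\le\epsilon\Big\},\qquad v^{-1}(\tau)=\sup\{\beta\in[0,1] : v(\beta)\le\tau\},$$ with the convention $0\,\phi(a/0)=a\lim_{t\to\infty}\phi(t)/t$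 for $a>0$ and $0\,\phi(0/0)=0$. For $N\ge1$ put $$\delta_n(N)=1-v\big((1+\tfrac1N)\,v^{-1}(1-\delta)\big),\quad \tilde\delta(N)=1-v^{-1}(1-\delta_n(N)),\quad \tilde\alpha(N)=1-\tilde\delta(N).$$ For $0<\alpha\le 1$ and reals $r_1,\dots,r_N$ let $\mathrm{Quantile}_\alpha(r_1,\dots,r_N)=\inf\{z\in\mathbb R : \tfrac1N\#\{i : r_i\le z\}\ge\alpha\}$. *Assumptions (Assumption 5.1).* The training data $Y^{(1)},\dots,Y^{(K)}$ and the calibration data $Y^{(K+1)},\dots,Y^{(K+L)}$ are random vectors with distribution $\mathcal Y$ on a common probability space; the calibration data are mutually independent (no independence among the training data is required). Moreover $v^{-1}(1-\delta)<1$, and $$K\ge\Big\lceil\frac{v^{-1}(1-\delta)}{1-v^{-1}(1-\delta)}\Big\rceil,\qquad L\ge\Big\lceil\frac{v^{-1}(1-\delta)}{1-v^{-1}(1-\delta)}\Big\rceil .$$ Consider the quantile reformulation: minimize $J(x)$ over $x\in\mathbb R^n$ subject to $\mathrm{Quantile}_{\tilde\alpha(K)}(f(x,Y^{(1)}),\dots,f(x,Y^{(K)}))\le0$,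 $h_i(x)\le0$ for $i\in\{1,\dots,m\}$, and $g_i(x)=0$ for $i\in\{1,\dots,p\}$. For $x\in\mathbb R^n$ let $\tilde C(x)=\mathrm{Quantile}_{\tilde\alpha(L)}(f(x,Y^{(K+1)}),\dots,f(x,Y^{(K+L)}))$. *Conclusion.* (i) For every realization of the training data and every optimal solution $x_2^*$ of the quantile reformulation for these data, $$\inf_{\mathcal Y'\in\mathcal P(\mathcal Y,\epsilon)}\mathrm{Prob}_m\big(f(x_2^*,Y)\le\tilde C(x_2^*)\big)\ge1-\delta,\qquad h_i(x_2^*)\le0\ (1\le i\le m),\qquad g_i(x_2^*)=0\ (1\le i\le p),$$ where $x_2^*$ is held fixed and $\mathrm{Prob}_m$ is the joint probability over the calibration data and the test point $Y\sim\mathcal Y'$, drawn independently of the calibration data. (ii) The same holds when the training data are random as well: if $x_2^*$ is a random vector, independent of the calibration data, that is almost surely an optimal solution of the quantile reformulation, then the displayed bound on the probability holds with $\mathrm{Prob}_m$ the joint probability over $x_2^*$, the calibration data and $Y\sim\mathcal Y'$ drawn independently of both, and the constraints on $h_i$ and $g_i$ hold almost surely. -/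

import Mathlib

open MeasureTheory ProbabilityTheory

noncomputable section

namespace RobustCPP

/-- The empirical quantile `inf {z ∈ ℝ | Prob(Z ≤ z) ≥ α}`, where `Z` is distributed according to
the empirical distribution of the `N` numbers `R 0, …, R (N - 1)`, which is to say
`Prob(Z ≤ z) = #{i | R i ≤ z} / N`. For `0 < α ≤ 1` and `1 ≤ N` the set is nonempty and
bounded below. -/
def quantile {N : ℕ} (α : ℝ) (R : Fin N → ℝ) : ℝ :=
  sInf {z : ℝ | α ≤ ((Finset.univ.filter fun i => R i ≤ z).card : ℝ) / (N : ℝ)}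

/-- The divergence `D_φ(μ, ν) = ∫ φ(dμ/dν) dν` generated by `φ`, for `μ` absolutely continuous with
respect to `ν`. It is `+∞` if `μ` is not absolutely continuous, and also if `φ(dμ/dν)` is not
integrable: a convex `φ` has an affine minorant, so its integral is then `+∞`. -/
def fDiv {E : Type*} [MeasurableSpace E] (φ : ℝ → ℝ) (μ ν : Measure E) : EReal :=
  open scoped Classical in
  if μ ≪ ν ∧ Integrable (fun x => φ (μ.rnDeriv ν x).toReal) ν then
    ((∫ x, φ (μ.rnDeriv ν x).toReal ∂ν : ℝ) : EReal)
  else ⊤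

/-- The probability distributions within divergence `ε` of `ν`. -/
def ambiguitySet {E : Type*} [MeasurableSpace E] (φ : ℝ → ℝ) (ε : ℝ) (ν : Measure E) :
    Set (ProbabilityMeasure E) :=
  {μ | fDiv φ (μ : Measure E) ν ≤ (ε : EReal)}

/-- The expression `b * φ (a / b)`, for `a, b ≥ 0`, with the usual convention
`0 * φ (a / 0) = a * lim_{t → ∞} φ(t) / t` (hence `0 * φ (0 / 0) = 0`). For convex `φ` the limit
exists in `(-∞, ∞]`. -/
def perspective (φ : ℝ → ℝ) (b a : ℝ) : EReal :=
  if b = 0 then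
    (a : EReal) * Filter.limsup (fun t : ℝ => ((φ t / t : ℝ) : EReal)) Filter.atTop
  else ((b * φ (a / b) : ℝ) : EReal)

/-- `v(β) = inf {z ∈ [0,1] | β φ(z/β) + (1-β) φ((1-z)/(1-β)) ≤ ε}` for `β ∈ [0,1]`. -/
def v (φ : ℝ → ℝ) (ε β : ℝ) : ℝ :=
  sInf {z : ℝ | z ∈ Set.Icc (0 : ℝ) 1 ∧
    perspective φ β z + perspective φ (1 - β) (1 - z) ≤ (ε : EReal)}

/-- `v⁻¹(τ) = sup {β ∈ [0,1] | v(β) ≤ τ}` for `τ ≥ 0`. -/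
def vInv (φ : ℝ → ℝ) (ε τ : ℝ) : ℝ :=
  sSup {β : ℝ | β ∈ Set.Icc (0 : ℝ) 1 ∧ v φ ε β ≤ τ}

/-- `δ_n(N) = 1 - v((1 + 1/N) v⁻¹(1 - δ))`. -/
def deltaN (φ : ℝ → ℝ) (ε δ : ℝ) (N : ℕ) : ℝ :=
  1 - v φ ε ((1 + 1 / (N : ℝ)) * vInv φ ε (1 - δ))

/-- The robust failure probability `δ̃(N) = 1 - v⁻¹(1 - δ_n(N))`. -/
def deltaTilde (φ : ℝ → ℝ) (ε δ : ℝ) (N : ℕ) : ℝ :=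
  1 - vInv φ ε (1 - deltaN φ ε δ N)

/-- The robust level `α̃(N) = 1 - δ̃(N)`. -/
def alphaTilde (φ : ℝ → ℝ) (ε δ : ℝ) (N : ℕ) : ℝ :=
  1 - deltaTilde φ ε δ N

/-- The feasible set, at level `α` and for the training data `y`, of the quantile reformulation
with inequality constraints `h i x ≤ 0` and equality constraints `g j x = 0`. -/
def feasibleSet {X E : Type*} {m p K : ℕ} (α : ℝ) (f : X → E → ℝ) (h : Fin m → X → ℝ)
    (g : Fin p → X → ℝ) (y : Fin K → E) : Set X :=
  {x | quantile α (fun k => f x (y k)) ≤ 0 ∧ (∀ i, h i x ≤ 0) ∧ ∀ j, g j x = 0}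

/-- `x` is an optimal solution of the quantile reformulation `min J` over the feasible set. -/
def IsOptimalSolution {X E : Type*} {m p K : ℕ} (α : ℝ) (J : X → ℝ) (f : X → E → ℝ)
    (h : Fin m → X → ℝ) (g : Fin p → X → ℝ) (y : Fin K → E) (x : X) : Prop :=
  x ∈ feasibleSet α f h g y ∧ IsMinOn J (feasibleSet α f h g y) x

/-- The calibrated bound `C̃(x)`: the empirical quantile of `f(x, c 0), …, f(x, c (L - 1))` at the
robust level `α̃(L)`, for the calibration data `c`. -/
def calibratedBound {X E : Type*} {L : ℕ} (φ : ℝ → ℝ) (ε δ : ℝ) (f : X → E → ℝ)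
    (c : Fin L → E) (x : X) : ℝ :=
  quantile (alphaTilde φ ε δ L) (fun i => f x (c i))

end RobustCPP

end

namespace RobustCPP

/-! ### Convex generators and data processing -/

/-! Write `b = v⁻¹(1-δ)`. The coverage event contains the event `A` that fewer than `α̃(L) L`
calibration scores lie strictly below the test score. When the test point also has law `𝒴`,
exchangeability of the `L + 1` scores gives `A` probability at least `α̃(L) L / (L + 1)`, which is
at least `b` because the factor `1 + 1/L` in `δ_n` cancels `L / (L + 1)`
(`prob_numBelow_lt_of_indep`).

Passing to a shifted test law changes only the law of `y`. The conditional probability of `A` given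
`y` is a `[0,1]`-valued test function, so the data processing inequality bounds its shifted mean
below by `v` of its original mean (`v_integral_le`). It remains that `v ≥ 1 - δ` on `[b, 1]`: above
`b` this is the definition of the supremum, at `b` itself it needs convexity of `φ` (`le_v_vInv`).

The training data enter only through the solution, whose feasibility gives the constraints on `h`
and `g`. -/

theorem exists_affine_minorant {φ : ℝ → ℝ} (hφ : ConvexOn ℝ (Set.Ici 0) φ) {s : ℝ} (hs : 0 < s) :
    ∃ c : ℝ, ∀ t, 0 ≤ t → φ s + c * (t - s) ≤ φ t := by
  have hint : s ∈ interior (Set.Ici (0 : ℝ)) := by simpa using hs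
  refine ⟨derivWithin φ (Set.Ioi s) s, fun t ht => ?_⟩
  rcases lt_trichotomy t s with hts | rfl | hst
  · have h1 := (hφ.slope_le_leftDeriv_of_mem_interior (Set.mem_Ici.2 ht) hint hts).trans
      (hφ.leftDeriv_le_rightDeriv_of_mem_interior hint)
    rw [slope_def_field, div_le_iff₀ (by linarith)] at h1
    linarith
  · simp
  · have h1 := hφ.rightDeriv_le_slope_of_mem_interior hint (Set.mem_Ici.2 ht) hst
    rw [slope_def_field, le_div_iff₀ (by linarith)] at h1
    linarith

/-- Jensen's inequality for the perspective, weighted by `w`. -/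
theorem perspective_integral_le {E : Type*} [MeasurableSpace E] {φ : ℝ → ℝ}
    (hφ : ConvexOn ℝ (Set.Ici 0) φ) {μ ν : Measure E} [IsProbabilityMeasure μ]
    [IsProbabilityMeasure ν] (hμν : μ ≪ ν)
    (hint : Integrable (fun x => φ (μ.rnDeriv ν x).toReal) ν) {w : E → ℝ} (hw : Measurable w)
    (hw0 : ∀ x, 0 ≤ w x) (hw1 : ∀ x, w x ≤ 1) :
    perspective φ (∫ x, w x ∂ν) (∫ x, w x ∂μ) ≤
      ((∫ x, w x * φ (μ.rnDeriv ν x).toReal ∂ν : ℝ) : EReal) := by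
  have hbd : ∀ x, ‖w x‖ ≤ 1 := fun x => by
    rw [Real.norm_of_nonneg (hw0 x)]; exact hw1 x
  have hwν : Integrable w ν := Integrable.of_bound hw.aestronglyMeasurable 1 (.of_forall hbd)
  have hwφ : Integrable (fun x => w x * φ (μ.rnDeriv ν x).toReal) ν :=
    hint.bdd_mul hw.aestronglyMeasurable (.of_forall hbd)
  have hwr : Integrable (fun x => w x * (μ.rnDeriv ν x).toReal) ν :=
    Measure.integrable_toReal_rnDeriv.bdd_mul hw.aestronglyMeasurable (.of_forall hbd)
  have hz : ∫ x, w x * (μ.rnDeriv ν x).toReal ∂ν = ∫ x, w x ∂μ := by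
    rw [← integral_toReal_rnDeriv_mul hμν]
    simp_rw [mul_comm]
  have hβ0 : 0 ≤ ∫ x, w x ∂ν := integral_nonneg hw0
  have hz0 : 0 ≤ ∫ x, w x ∂μ := integral_nonneg hw0
  -- If `w` has `ν`-mean zero, absolute continuity makes its `μ`-mean zero as well, so the recession
  -- slope in `perspective` is multiplied by `0`.
  rcases hβ0.eq_or_lt with hβ | hβ
  · have hae : w =ᵐ[ν] 0 := (integral_eq_zero_iff_of_nonneg hw0 hwν).1 hβ.symm
    have h1 : ∫ x, w x ∂μ = 0 := by
      rw [integral_congr_ae (hμν.ae_eq hae)]; simp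
    have h2 : ∫ x, w x * φ (μ.rnDeriv ν x).toReal ∂ν = 0 := by
      refine integral_eq_zero_of_ae ?_
      filter_upwards [hae] with x hx
      simp [hx]
    rw [h1, h2, ← hβ]
    simp [perspective]
  · rw [perspective, if_neg hβ.ne', EReal.coe_le_coe_iff]
    -- At ratio `0`, an endpoint of the domain, `φ` may have no supporting line. There the density
    -- vanishes almost everywhere on `w ≠ 0`, and equality holds.
    rcases hz0.eq_or_lt with hz' | hz'
    · rw [← hz', zero_div, ← integral_mul_const]
      have hae : (fun x => w x * (μ.rnDeriv ν x).toReal) =ᵐ[ν] 0 :=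
        (integral_eq_zero_iff_of_nonneg
          (fun x => mul_nonneg (hw0 x) ENNReal.toReal_nonneg) hwr).1 (hz.trans hz'.symm)
      refine (integral_congr_ae ?_).le
      filter_upwards [hae] with x hx
      rcases mul_eq_zero.1 hx with hx | hx <;> simp [hx]
    · obtain ⟨c, hc⟩ := exists_affine_minorant hφ (div_pos hz' hβ)
      set s := (∫ x, w x ∂μ) / ∫ x, w x ∂ν with hs
      have hsβ : s * ∫ x, w x ∂ν = ∫ x, w x ∂μ := div_mul_cancel₀ _ hβ.ne'
      have hle : ∫ x, ((φ s - c * s) * w x + c * (w x * (μ.rnDeriv ν x).toReal)) ∂ν ≤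
          ∫ x, w x * φ (μ.rnDeriv ν x).toReal ∂ν := by
        refine integral_mono ((hwν.const_mul _).add (hwr.const_mul _)) hwφ fun x => ?_
        have := mul_le_mul_of_nonneg_left
          (hc (μ.rnDeriv ν x).toReal ENNReal.toReal_nonneg) (hw0 x)
        dsimp only
        linarith
      rw [integral_add (hwν.const_mul _) (hwr.const_mul _), integral_const_mul,
        integral_const_mul, hz, ← hsβ] at hle
      linarith

/-- Data processing for the randomized binary test `w`: Jensen with weights `w` and `1 - w` bounds
the two perspectives, and the right-hand sides add up to the divergence. Hence `∫ w dμ` is a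
competitor in the infimum defining `v (∫ w dν)`. -/
theorem v_integral_le {E : Type*} [MeasurableSpace E] {φ : ℝ → ℝ} {ε : ℝ}
    (hφ : ConvexOn ℝ (Set.Ici 0) φ) {μ ν : Measure E} [IsProbabilityMeasure μ]
    [IsProbabilityMeasure ν] (hD : fDiv φ μ ν ≤ (ε : EReal)) {w : E → ℝ} (hw : Measurable w)
    (hw0 : ∀ x, 0 ≤ w x) (hw1 : ∀ x, w x ≤ 1) :
    v φ ε (∫ x, w x ∂ν) ≤ ∫ x, w x ∂μ := by
  have hbd : ∀ x, ‖w x‖ ≤ 1 := fun x => by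
    rw [Real.norm_of_nonneg (hw0 x)]; exact hw1 x
  have hwi : ∀ (ρ : Measure E) [IsProbabilityMeasure ρ], Integrable w ρ := fun ρ _ =>
    Integrable.of_bound hw.aestronglyMeasurable 1 (.of_forall hbd)
  have hcompl : ∀ (ρ : Measure E) [IsProbabilityMeasure ρ],
      ∫ x, (1 - w x) ∂ρ = 1 - ∫ x, w x ∂ρ := fun ρ _ => by
    rw [integral_sub (integrable_const _) (hwi ρ)]; simp
  unfold fDiv at hD
  split_ifs at hD with hac
  · obtain ⟨hμν, hint⟩ := hac
    refine csInf_le ⟨0, fun z hz => hz.1.1⟩ ⟨⟨integral_nonneg hw0, ?_⟩, ?_⟩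
    · have := hcompl μ
      have h0 : 0 ≤ ∫ x, (1 - w x) ∂μ := integral_nonneg fun x => sub_nonneg.2 (hw1 x)
      linarith
    · have h1 := perspective_integral_le hφ hμν hint hw hw0 hw1
      have h2 := perspective_integral_le hφ hμν hint (w := fun x => 1 - w x)
        (measurable_const.sub hw) (fun x => sub_nonneg.2 (hw1 x))
        (fun x => sub_le_self _ (hw0 x))
      rw [hcompl, hcompl] at h2
      refine (add_le_add h1 h2).trans (le_trans (le_of_eq ?_) hD)
      rw [← EReal.coe_add, ← integral_add]
      · congr 2 with x
        ring
      · exact hint.bdd_mul hw.aestronglyMeasurable (.of_forall hbd)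
      · refine hint.bdd_mul (c := 1) (measurable_const.sub hw).aestronglyMeasurable
          (.of_forall fun x => ?_)
        rw [Real.norm_of_nonneg (sub_nonneg.2 (hw1 x))]
        exact sub_le_self _ (hw0 x)
  · simp at hD

/-! ### The functions `v` and `v⁻¹` -/

theorem v_le_self {φ : ℝ → ℝ} {ε β : ℝ} (hε : 0 < ε) (hφ1 : φ 1 = 0)
    (hβ : β ∈ Set.Icc (0 : ℝ) 1) : v φ ε β ≤ β := by
  have hself : ∀ b, perspective φ b b = 0 := fun b => by
    by_cases hb : b = 0 <;> simp [perspective, hb, hφ1]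
  refine csInf_le ⟨0, fun z hz => hz.1.1⟩ ⟨hβ, ?_⟩
  rw [hself, hself, add_zero]
  exact_mod_cast hε.le

theorem le_vInv {φ : ℝ → ℝ} {ε β τ : ℝ} (hβ : β ∈ Set.Icc (0 : ℝ) 1) (hv : v φ ε β ≤ τ) :
    β ≤ vInv φ ε τ :=
  le_csSup ⟨1, fun _ hb => hb.1.2⟩ ⟨hβ, hv⟩

theorem vInv_le_one (φ : ℝ → ℝ) (ε τ : ℝ) : vInv φ ε τ ≤ 1 :=
  Real.sSup_le (fun _ hb => hb.1.2) zero_le_one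

theorem lt_v_of_vInv_lt {φ : ℝ → ℝ} {ε β τ : ℝ} (hβ : β ∈ Set.Icc (0 : ℝ) 1)
    (h : vInv φ ε τ < β) : τ < v φ ε β := by
  by_contra! hle
  exact (le_vInv hβ hle).not_gt h

/-- If `v(b) < τ`, some `z < τ` is admissible for `b`. The binary divergence is jointly convex and
vanishes at `(1, 1)`, so moving `(z, b)` slightly towards `(1, 1)` stays admissible, keeps `z ≤ τ`
and increases `b`, contradicting the supremum. -/
theorem le_v_vInv {φ : ℝ → ℝ} {ε τ : ℝ} (hφ : ConvexOn ℝ (Set.Ici 0) φ) (hφ1 : φ 1 = 0)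
    (hε : 0 < ε) (h0 : 0 < vInv φ ε τ) (h1 : vInv φ ε τ < 1) : τ ≤ v φ ε (vInv φ ε τ) := by
  by_contra! hlt
  set b := vInv φ ε τ with hb
  have hne : {z : ℝ | z ∈ Set.Icc (0 : ℝ) 1 ∧
      perspective φ b z + perspective φ (1 - b) (1 - z) ≤ (ε : EReal)}.Nonempty := by
    refine ⟨b, ⟨h0.le, h1.le⟩, ?_⟩
    have h1b : 1 - b ≠ 0 := by linarith
    simp only [perspective, h0.ne', h1b, if_false, div_self, hφ1, ne_eq, not_false_eq_true,
      mul_zero, EReal.coe_zero, add_zero]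
    exact_mod_cast hε.le
  obtain ⟨z, ⟨hz, hzε⟩, hzτ⟩ := exists_lt_of_csInf_lt hne hlt
  have h1b : 0 < 1 - b := by linarith
  rw [perspective, perspective, if_neg h0.ne', if_neg h1b.ne', ← EReal.coe_add,
    EReal.coe_le_coe_iff] at hzε
  -- move from `(z, b)` a little towards `(1, 1)`
  obtain ⟨t, ht0, ht1, htτ⟩ : ∃ t : ℝ, 0 < t ∧ t < 1 ∧ z + t * (1 - z) ≤ τ := by
    refine ⟨min (1 / 2) (τ - z), lt_min (by norm_num) (by linarith),
      (min_le_left _ _).trans_lt (by norm_num), ?_⟩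
    have h2 : min (1 / 2) (τ - z) ≤ τ - z := min_le_right _ _
    have h3 : 0 ≤ min (1 / 2) (τ - z) := le_min (by norm_num) (by linarith)
    nlinarith [hz.1, hz.2]
  have hβb : b < b + t * (1 - b) := by nlinarith
  have hβ1 : b + t * (1 - b) < 1 := by nlinarith
  have hβ0 : 0 < b + t * (1 - b) := h0.trans hβb
  suffices hv : v φ ε (b + t * (1 - b)) ≤ z + t * (1 - z) from
    (lt_v_of_vInv_lt ⟨hβ0.le, hβ1.le⟩ hβb).not_ge (hv.trans htτ)
  refine csInf_le ⟨0, fun y hy => hy.1.1⟩ ⟨⟨?_, ?_⟩, ?_⟩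
  · nlinarith [hz.1, hz.2]
  · nlinarith [hz.1, hz.2]
  · rw [perspective, perspective, if_neg hβ0.ne', if_neg (by linarith), ← EReal.coe_add,
      EReal.coe_le_coe_iff]
    -- Both complements shrink by `1 - t`, so the second perspective scales by exactly `1 - t`. The
    -- first scales by at most that, its new ratio being a convex combination of `z / b` and `1`,
    -- with `φ 1 = 0`.
    have hsnd : (1 - (z + t * (1 - z))) / (1 - (b + t * (1 - b))) = (1 - z) / (1 - b) := by
      have h1t : 1 - t ≠ 0 := by linarith
      rw [show 1 - (z + t * (1 - z)) = (1 - t) * (1 - z) by ring,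
        show 1 - (b + t * (1 - b)) = (1 - t) * (1 - b) by ring, mul_div_mul_left _ _ h1t]
    have hw0 : 0 ≤ (1 - t) * b / (b + t * (1 - b)) :=
      div_nonneg (mul_nonneg (by linarith) h0.le) hβ0.le
    have hconv := hφ.2 (Set.mem_Ici.2 (div_nonneg hz.1 h0.le)) (Set.mem_Ici.2 zero_le_one)
      hw0 (div_nonneg ht0.le hβ0.le)
      (by rw [← add_div, div_eq_one_iff_eq hβ0.ne']; ring)
    have harg : (1 - t) * b / (b + t * (1 - b)) * (z / b) + t / (b + t * (1 - b)) * 1 =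
        (z + t * (1 - z)) / (b + t * (1 - b)) := by
      field_simp
      ring
    simp only [smul_eq_mul] at hconv
    rw [harg, hφ1, mul_zero, add_zero] at hconv
    have hfst := mul_le_mul_of_nonneg_left hconv hβ0.le
    rw [show (b + t * (1 - b)) * ((1 - t) * b / (b + t * (1 - b)) * φ (z / b)) =
      (1 - t) * (b * φ (z / b)) by field_simp] at hfst
    rw [hsnd]
    nlinarith

/-! ### Ranks and exchangeability -/

/-- Some `z < y` already reaches the level, so the infimum need not be attained. The bound `α ≤ 1`
excludes the default value `sInf ∅ = 0`. -/
theorem le_card_lt_of_quantile_lt {N : ℕ} (hN : 0 < N) {α : ℝ} (hα : α ≤ 1) {R : Fin N → ℝ} {y : ℝ}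
    (hy : quantile α R < y) :
    α * N ≤ ((Finset.univ.filter fun i => R i < y).card : ℝ) := by
  have hN' : (0 : ℝ) < N := by exact_mod_cast hN
  have hne : {z : ℝ | α ≤ ((Finset.univ.filter fun i => R i ≤ z).card : ℝ) / (N : ℝ)}.Nonempty := by
    obtain ⟨M, hM⟩ := (Set.finite_range R).bddAbove
    refine ⟨M, ?_⟩
    have : (Finset.univ.filter fun i => R i ≤ M) = Finset.univ :=
      Finset.filter_true_of_mem fun i _ => hM ⟨i, rfl⟩
    simp [this, div_self hN'.ne', hα]
  obtain ⟨z, hz, hzy⟩ := exists_lt_of_csInf_lt hne hy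
  refine ((le_div_iff₀ hN').1 hz).trans (Nat.cast_le.2 (Finset.card_le_card ?_))
  exact Finset.monotone_filter_right _ fun i _ hi => hi.trans_lt hzy

/-- Take an index of least value among those of rank at least `c`: everything strictly below it has
rank less than `c`, and there are at least `c` such indices. Ties do no harm. -/
theorem le_card_rank_lt {ι : Type*} [Fintype ι] (R : ι → ℝ) {c : ℝ} (hc : c ≤ Fintype.card ι) :
    c ≤ ((Finset.univ.filter fun j =>
      ((Finset.univ.filter fun i => R i < R j).card : ℝ) < c).card : ℝ) := by
  by_cases hall : ∀ j, ((Finset.univ.filter fun i => R i < R j).card : ℝ) < c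
  · simpa [hall] using hc
  · push Not at hall
    obtain ⟨j, hj, hmin⟩ := Finset.exists_min_image
      (Finset.univ.filter fun j => c ≤ ((Finset.univ.filter fun i => R i < R j).card : ℝ)) R
      (by obtain ⟨j, hj⟩ := hall; exact ⟨j, by simpa using hj⟩)
    refine (Finset.mem_filter.1 hj).2.trans (Nat.cast_le.2 (Finset.card_le_card ?_))
    refine Finset.monotone_filter_right _ fun i _ hi => ?_
    by_contra! hci
    exact (hmin i (by simpa using hci)).not_gt hi

/-- The number of the `c i` at which `r` is smaller than at `y`. -/
noncomputable def numBelow {E : Type*} {L : ℕ} (r : E → ℝ) (y : E) (c : Fin L → E) : ℕ :=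
  (Finset.univ.filter fun i => r (c i) < r y).card

theorem numBelow_eq_sum {E : Type*} {L : ℕ} (r : E → ℝ) (y : E) (c : Fin L → E) :
    numBelow r y c = ∑ i, if r (c i) < r y then 1 else 0 :=
  Finset.card_filter _ _

theorem measurable_numBelow {A X E : Type*} [MeasurableSpace A] [MeasurableSpace X]
    [MeasurableSpace E] {L : ℕ} {f : X → E → ℝ} (hf : Measurable (Function.uncurry f))
    {x : A → X} (hx : Measurable x) {y : A → E} (hy : Measurable y) {c : A → Fin L → E}
    (hc : Measurable c) : Measurable fun a => (numBelow (f (x a)) (y a) (c a) : ℝ) := by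
  have h1 : Measurable fun a => f (x a) (y a) := hf.comp (hx.prodMk hy)
  have h2 : ∀ i, Measurable fun a => f (x a) (c a i) := fun i =>
    hf.comp (hx.prodMk ((measurable_pi_apply i).comp hc))
  simp_rw [numBelow_eq_sum]
  push_cast
  refine Finset.measurable_sum _ fun i _ => ?_
  exact Measurable.ite (measurableSet_lt (h2 i) h1) measurable_const measurable_const

/-- Among `L + 1` independent points, the events `S j` that point `j` has rank below `c` are equally
likely. Their probabilities sum to the expected number of such points, which is at least `c`
pointwise. -/
theorem prob_numBelow_lt {E : Type*} [MeasurableSpace E] (ν : Measure E) [IsProbabilityMeasure ν]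
    {L : ℕ} {r : E → ℝ} (hr : Measurable r) {c : ℝ} (hc : c ≤ L + 1) :
    ENNReal.ofReal (c / (L + 1)) ≤ (ν.prod (Measure.pi fun _ : Fin L => ν))
      {q | (numBelow r q.1 q.2 : ℝ) < c} := by
  set B : Set (E × (Fin L → E)) := {q | (numBelow r q.1 q.2 : ℝ) < c} with hB
  have hBm : MeasurableSet B :=
    measurableSet_lt (measurable_numBelow (X := Unit) (f := fun _ => r) (hr.comp measurable_snd)
      (measurable_const (a := ())) measurable_fst measurable_snd) measurable_const
  set π := Measure.pi fun _ : Fin (L + 1) => ν with hπ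
  set S : Fin (L + 1) → Set (Fin (L + 1) → E) := fun j =>
    {a | ((Finset.univ.filter fun i => r (a i) < r (a j)).card : ℝ) < c} with hS
  have hpre : ∀ j, S j = MeasurableEquiv.piFinSuccAbove (fun _ => E) j ⁻¹' B := fun j => by
    ext a
    have : (Finset.univ.filter fun i => r (a i) < r (a j)).card =
        numBelow r (a j) (fun i => a (j.succAbove i)) := by
      -- The term split off is zero, since no score is strictly below itself.
      rw [numBelow_eq_sum, Finset.card_filter, Fin.sum_univ_succAbove _ j]
      simp
    simp only [hS, hB, Set.mem_ofPred_eq, Set.mem_preimage, this]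
    rfl
  have hmeas : ∀ j, MeasurableSet (S j) := fun j => by
    rw [hpre]; exact (MeasurableEquiv.measurable _) hBm
  have hprob : ∀ j, π (S j) = (ν.prod (Measure.pi fun _ : Fin L => ν)) B := fun j => by
    rw [hpre]
    exact (measurePreserving_piFinSuccAbove (fun _ => ν) j).measure_preimage hBm.nullMeasurableSet
  have hsum : ENNReal.ofReal c ≤ ∑ j, π (S j) := by
    calc ENNReal.ofReal c = ∫⁻ _, ENNReal.ofReal c ∂π := by simp
      _ ≤ ∫⁻ a, ∑ j, (S j).indicator 1 a ∂π := by
          refine lintegral_mono fun a => ?_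
          have h1 := le_card_rank_lt (fun i => r (a i)) (c := c) (by simpa using hc)
          refine (ENNReal.ofReal_le_ofReal h1).trans (le_of_eq ?_)
          rw [ENNReal.ofReal_natCast, Finset.card_filter]
          push_cast
          exact Finset.sum_congr rfl fun j _ => by simp [hS, Set.indicator_apply]
      _ = ∑ j, π (S j) := by
          rw [lintegral_finsetSum _ fun j _ => measurable_one.indicator (hmeas j)]
          exact Finset.sum_congr rfl fun j _ => lintegral_indicator_one (hmeas j)
  simp only [hprob, Finset.sum_const, Finset.card_univ, Fintype.card_fin, nsmul_eq_mul] at hsum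
  have hL : (0 : ℝ) < (L : ℝ) + 1 := by positivity
  rw [ENNReal.ofReal_div_of_pos hL]
  refine ENNReal.div_le_of_le_mul' ?_
  have : ENNReal.ofReal ((L : ℝ) + 1) = ((L + 1 : ℕ) : ENNReal) := by
    rw [← ENNReal.ofReal_natCast]; push_cast; rfl
  rwa [this]

/-- By independence the joint law of the decision and the calibration data is a product, so the
decision can be frozen at `u`, the bound applied to the score `f u`, and the result integrated over
`u`. -/
theorem prob_numBelow_lt_of_indep {X E Ω : Type*} [MeasurableSpace X] [MeasurableSpace E]
    [MeasurableSpace Ω] {f : X → E → ℝ} (hf : Measurable (Function.uncurry f))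
    (ν : Measure E) [IsProbabilityMeasure ν] (P : Measure Ω) [IsProbabilityMeasure P]
    {L : ℕ} {Y : Fin L → Ω → E} (hY : ∀ i, Measurable (Y i)) (hlaw : ∀ i, P.map (Y i) = ν)
    (hindep : iIndepFun Y P) {x : Ω → X} (hx : Measurable x)
    (hxY : IndepFun x (fun ω i => Y i ω) P) {c : ℝ} (hc : c ≤ L + 1) :
    ENNReal.ofReal (c / (L + 1)) ≤
      (ν.prod P) {q | (numBelow (f (x q.2)) q.1 (fun i => Y i q.2) : ℝ) < c} := by
  have hYm : Measurable fun ω i => Y i ω := measurable_pi_lambda _ hY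
  have hmap : P.map (fun ω => (x ω, fun i => Y i ω)) =
      (P.map x).prod (Measure.pi fun _ => ν) := by
    rw [(indepFun_iff_map_prod_eq_prod_map_map hx.aemeasurable hYm.aemeasurable).1 hxY,
      (iIndepFun_iff_map_fun_eq_pi_map fun i => (hY i).aemeasurable).1 hindep]
    simp_rw [hlaw]
  set B : Set (E × X × (Fin L → E)) := {q | (numBelow (f q.2.1) q.1 q.2.2 : ℝ) < c} with hB
  have hBm : MeasurableSet B :=
    measurableSet_lt (measurable_numBelow hf (measurable_fst.comp measurable_snd) measurable_fst
      (measurable_snd.comp measurable_snd)) measurable_const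
  have : IsProbabilityMeasure (P.map x) := Measure.isProbabilityMeasure_map hx.aemeasurable
  have hset : {q : E × Ω | (numBelow (f (x q.2)) q.1 (fun i => Y i q.2) : ℝ) < c} =
      (fun q : E × Ω => (q.1, x q.2, fun i => Y i q.2)) ⁻¹' B := rfl
  have hsec : Measurable fun p : X × (Fin L → E) => ν ((fun y => (y, p)) ⁻¹' B) :=
    measurable_measure_prodMk_right hBm
  have hpre : MeasurableSet
      ((fun q : E × Ω => (q.1, x q.2, fun i => Y i q.2)) ⁻¹' B) :=
    (measurable_fst.prodMk ((hx.comp measurable_snd).prodMk (hYm.comp measurable_snd))) hBm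
  rw [hset, Measure.prod_apply_symm hpre]
  change _ ≤ ∫⁻ ω, (fun p : X × (Fin L → E) => ν ((fun y => (y, p)) ⁻¹' B))
    ((fun ω => (x ω, fun i => Y i ω)) ω) ∂P
  rw [← lintegral_map hsec (hx.prodMk hYm), hmap, lintegral_prod _ hsec.aemeasurable]
  calc ENNReal.ofReal (c / (L + 1)) = ∫⁻ _, ENNReal.ofReal (c / (L + 1)) ∂(P.map x) := by simp
    _ ≤ _ := by
      refine lintegral_mono fun u => ?_
      have hu : Measurable (f u) := hf.comp (measurable_const.prodMk measurable_id)
      refine (prob_numBelow_lt ν hu hc).trans (le_of_eq ?_)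
      rw [Measure.prod_apply_symm]
      · rfl
      · exact measurableSet_lt (measurable_numBelow (X := Unit) (f := fun _ => f u)
          (hu.comp measurable_snd) (measurable_const (a := ())) measurable_fst measurable_snd)
          measurable_const

/-! ### Coverage of the calibrated bound under distribution shift -/

theorem measureReal_prod_eq_integral {E Ω : Type*} [MeasurableSpace E] [MeasurableSpace Ω]
    (μ : Measure E) [IsProbabilityMeasure μ] (P : Measure Ω) [IsProbabilityMeasure P]
    {A : Set (E × Ω)} (hA : MeasurableSet A) :
    (μ.prod P).real A = ∫ y, P.real (Prod.mk y ⁻¹' A) ∂μ := by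
  rw [measureReal_def, Measure.prod_apply hA]
  exact (integral_toReal (measurable_measure_prodMk_left hA).aemeasurable
    (.of_forall fun _ => measure_lt_top _ _)).symm

theorem le_prob_le_calibratedBound {X E Ω : Type*} [MeasurableSpace X] [MeasurableSpace E]
    [MeasurableSpace Ω] {f : X → E → ℝ} (hf : Measurable (Function.uncurry f))
    {δ ε : ℝ} (hδ : δ ∈ Set.Ioo (0 : ℝ) 1) (hε : 0 < ε)
    {φ : ℝ → ℝ} (hφ : ConvexOn ℝ (Set.Ici 0) φ) (hφ1 : φ 1 = 0)
    (ν : Measure E) [IsProbabilityMeasure ν] (P : Measure Ω) [IsProbabilityMeasure P]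
    {L : ℕ} {Y : Fin L → Ω → E} (hY : ∀ i, Measurable (Y i)) (hlaw : ∀ i, P.map (Y i) = ν)
    (hindep : iIndepFun Y P) (hv : vInv φ ε (1 - δ) < 1)
    (hL : ⌈vInv φ ε (1 - δ) / (1 - vInv φ ε (1 - δ))⌉ ≤ (L : ℤ))
    {x : Ω → X} (hx : Measurable x) (hxY : IndepFun x (fun ω i => Y i ω) P)
    {μ : Measure E} [IsProbabilityMeasure μ] (hμ : fDiv φ μ ν ≤ (ε : EReal)) :
    ENNReal.ofReal (1 - δ) ≤ (μ.prod P)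
      {q | f (x q.2) q.1 ≤ calibratedBound φ ε δ f (fun i => Y i q.2) (x q.2)} := by
  set b := vInv φ ε (1 - δ) with hb
  have h1δ : 1 - δ ∈ Set.Icc (0 : ℝ) 1 := ⟨by linarith [hδ.2], by linarith [hδ.1]⟩
  have hb0 : 0 < b :=
    (by linarith [hδ.2] : 0 < 1 - δ).trans_le (le_vInv h1δ (v_le_self hε hφ1 h1δ))
  have h1b : 0 < 1 - b := by linarith
  have hLr : b / (1 - b) ≤ L := by
    have := Int.ceil_le.1 hL
    exact_mod_cast this
  have hL0 : (0 : ℝ) < L := (div_pos hb0 h1b).trans_le hLr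
  have hLpos : 0 < L := by exact_mod_cast hL0
  rw [div_le_iff₀ h1b] at hLr
  -- `α̃(L)` is `v⁻¹(v(β))` at `β = (1 + 1/L) b`, hence at least `β` once `β ≤ 1`. That is exactly
  -- the lower bound on `L`.
  have hlevel : (1 + 1 / (L : ℝ)) * b ≤ alphaTilde φ ε δ L := by
    simp only [alphaTilde, deltaTilde, deltaN, sub_sub_cancel]
    refine le_vInv ⟨by positivity, ?_⟩ le_rfl
    have : (1 + 1 / (L : ℝ)) * b = (L + 1) * b / L := by field_simp
    rw [this, div_le_one hL0]
    linarith
  have hα1 : alphaTilde φ ε δ L ≤ 1 := by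
    simp only [alphaTilde, deltaTilde, sub_sub_cancel]
    exact vInv_le_one _ _ _
  set c := alphaTilde φ ε δ L * L with hc
  have hcL : c ≤ L + 1 := by nlinarith
  have hbc : b ≤ c / (L + 1) := by
    rw [le_div_iff₀ (by positivity)]
    have : (1 + 1 / (L : ℝ)) * b * L = b * (L + 1) := by field_simp
    nlinarith
  set A : Set (E × Ω) := {q | (numBelow (f (x q.2)) q.1 (fun i => Y i q.2) : ℝ) < c} with hA
  have hAm : MeasurableSet A :=
    measurableSet_lt (measurable_numBelow hf (hx.comp measurable_snd) measurable_fst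
      ((measurable_pi_lambda _ hY).comp measurable_snd)) measurable_const
  have hsub : A ⊆ {q | f (x q.2) q.1 ≤ calibratedBound φ ε δ f (fun i => Y i q.2) (x q.2)} := by
    intro q hq
    by_contra hlt
    exact (le_card_lt_of_quantile_lt hLpos hα1 (not_le.1 hlt)).not_gt hq
  have hbA : b ≤ (ν.prod P).real A := by
    rw [measureReal_def, ← ENNReal.ofReal_le_iff_le_toReal (measure_ne_top _ _)]
    exact (ENNReal.ofReal_le_ofReal hbc).trans
      (prob_numBelow_lt_of_indep hf ν P hY hlaw hindep hx hxY hcL)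
  -- Monotonicity of `v` is not needed: a value above the supremum violates `v ≤ 1 - δ` by
  -- definition.
  have hvA : 1 - δ ≤ v φ ε ((ν.prod P).real A) := by
    rcases hbA.eq_or_lt with heq | hlt
    · rw [← heq]
      exact le_v_vInv hφ hφ1 hε hb0 hv
    · exact (lt_v_of_vInv_lt ⟨measureReal_nonneg, measureReal_le_one⟩ hlt).le
  have htransfer : v φ ε ((ν.prod P).real A) ≤ (μ.prod P).real A := by
    rw [measureReal_prod_eq_integral ν P hAm, measureReal_prod_eq_integral μ P hAm]
    exact v_integral_le hφ hμ (measurable_measure_prodMk_left hAm).ennreal_toReal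
      (fun _ => measureReal_nonneg) (fun _ => measureReal_le_one)
  refine le_trans ?_ (measure_mono hsub)
  rw [ENNReal.ofReal_le_iff_le_toReal (measure_ne_top _ _)]
  exact hvA.trans htransfer

end RobustCPP

theorem theorem5p2
    -- decision space ℝⁿ, parameter space ℝᵈ, and the data of the optimization problem
    {n d m p : ℕ}
    (J : EuclideanSpace ℝ (Fin n) → ℝ)
    (f : EuclideanSpace ℝ (Fin n) → EuclideanSpace ℝ (Fin d) → ℝ)
    (hf : Measurable (Function.uncurry f))
    (h : Fin m → EuclideanSpace ℝ (Fin n) → ℝ)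
    (g : Fin p → EuclideanSpace ℝ (Fin n) → ℝ)
    -- the failure probability, the size of the shift, the generator of the divergence
    (δ : ℝ) (hδ : δ ∈ Set.Ioo (0 : ℝ) 1)
    (ε : ℝ) (hε : 0 < ε)
    (φ : ℝ → ℝ) (hφ : ConvexOn ℝ (Set.Ici 0) φ) (hφ1 : φ 1 = 0)
    -- the data distribution, the training data and the calibration data
    (𝒴 : Measure (EuclideanSpace ℝ (Fin d))) [IsProbabilityMeasure 𝒴]
    {Ω : Type*} [MeasurableSpace Ω] (P : Measure Ω) [IsProbabilityMeasure P]
    {K L : ℕ}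
    (Ytr : Fin K → Ω → EuclideanSpace ℝ (Fin d))
    (hYtr : ∀ k, Measurable (Ytr k)) (hYtr_law : ∀ k, P.map (Ytr k) = 𝒴)
    (Ycal : Fin L → Ω → EuclideanSpace ℝ (Fin d))
    (hYcal : ∀ i, Measurable (Ycal i)) (hYcal_law : ∀ i, P.map (Ycal i) = 𝒴)
    (hYcal_indep : iIndepFun Ycal P)
    -- the size of the two datasets (the quotient is finite)
    (hv : RobustCPP.vInv φ ε (1 - δ) < 1)
    (hK : ⌈RobustCPP.vInv φ ε (1 - δ) / (1 - RobustCPP.vInv φ ε (1 - δ))⌉ ≤ (K : ℤ))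
    (hL : ⌈RobustCPP.vInv φ ε (1 - δ) / (1 - RobustCPP.vInv φ ε (1 - δ))⌉ ≤ (L : ℤ)) :
    -- for every realization of the training data, over the randomness in the test point, drawn
    -- independently of the calibration data, and in the calibration data
    (∀ (ω₀ : Ω) (x : EuclideanSpace ℝ (Fin n)),
      RobustCPP.IsOptimalSolution (RobustCPP.alphaTilde φ ε δ K) J f h g (fun k => Ytr k ω₀) x →
        ENNReal.ofReal (1 - δ) ≤
            (⨅ 𝒴' ∈ RobustCPP.ambiguitySet φ ε 𝒴,
              ((𝒴' : Measure (EuclideanSpace ℝ (Fin d))).prod P)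
                {q | f x q.1 ≤ RobustCPP.calibratedBound φ ε δ f (fun i => Ycal i q.2) x}) ∧
          (∀ i, h i x ≤ 0) ∧ ∀ j, g j x = 0) ∧
    -- the same for the solution as a random variable independent of the calibration data
    (∀ x : Ω → EuclideanSpace ℝ (Fin n), Measurable x →
      IndepFun x (fun ω i => Ycal i ω) P →
      (∀ᵐ ω ∂P, RobustCPP.IsOptimalSolution (RobustCPP.alphaTilde φ ε δ K) J f h g
        (fun k => Ytr k ω) (x ω)) →
        ENNReal.ofReal (1 - δ) ≤
            (⨅ 𝒴' ∈ RobustCPP.ambiguitySet φ ε 𝒴,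
              ((𝒴' : Measure (EuclideanSpace ℝ (Fin d))).prod P)
                {q | f (x q.2) q.1 ≤
                  RobustCPP.calibratedBound φ ε δ f (fun i => Ycal i q.2) (x q.2)}) ∧
          ∀ᵐ ω ∂P, (∀ i, h i (x ω) ≤ 0) ∧ ∀ j, g j (x ω) = 0) := by

  refine ⟨fun ω₀ x hx => ⟨?_, hx.1.2⟩, fun x hxm hxY hx => ⟨?_, hx.mono fun ω hω => hω.1.2⟩⟩
  -- A fixed solution is a constant random variable, independent of the calibration data.
  · exact le_iInf₂ fun 𝒴' h𝒴' => RobustCPP.le_prob_le_calibratedBound hf hδ hε hφ hφ1 𝒴 P hYcal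
      hYcal_law hYcal_indep hv hL measurable_const (indepFun_const_left x _) h𝒴'
  · exact le_iInf₂ fun 𝒴' h𝒴' => RobustCPP.le_prob_le_calibratedBound hf hδ hε hφ hφ1 𝒴 P hYcal
      hYcal_law hYcal_indep hv hL hxm hxY h𝒴'
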